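/- Let $d,k\ge 2$ be integers and let $\mathcal T=\mathcal T_{d,k}$ be the rooted plane tree whose root has $k$ children and all of whose other vertices have $d$ children (the children of each vertex being linearly ordered from left to right). Let $X=\partial\mathcal T$ be its compact space of ends. An almost automorphism of $\mathcal T$ is a triple $(A,B,\varphi)$, where $A,B$ are finite subtrees containing the root and $\varphi:\mathcal T\setminus A\to\mathcal T\setminus B$ is an isomorphism of rooted forests. The Neretin group $\mathcal N_{d,k}$ is the group of almost automorphisms, two of them being identified if they coincide outside a finite subtree; equivalently, it is the group of all homeomorphisms of $X$ induced by almost automorphisms. It carries the group topology for which the profinite group $\mathrm{Aut}(\mathcal T)$ of automorphisms of the rooted tree is an open subgroup. Thompson's group $F_{d,k}\le\mathcal N_{d,k}$ consists of the elements that are represented by an almost automorphism $(A,B,\varphi)$ such that $\varphi$ preserves the left-to-right order: for all vertices $u,v\notin A$, $u$ lies to the left of $v$ (on a different branch) if and only if $\varphi(u)$ lies to the left of $\varphi(v)$. For a locally compact group $G$, a closed subgroup $H$ is called confined if the closure of its conjugacy class in the Chabauty space of closed subgroups of $G$ does not contain the trivial subgroup. For a totally disconnected compact $G$-space $X$, let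 $\mathcal S_X$ be the set of all closed subgroups $H\le G$ such that for every non-empty clopen subset $\alpha\subseteq X$ the setwise stabilizer of $\alpha$ in $H$ fixes a probability measure on $\alpha$. Then, for all integers $d,k\ge2$, $F_{d,k}$ is a discrete (and closed) subgroup of $\mathcal N_{d,k}$, it belongs to $\mathcal S_X$ for $X=\partial\mathcal T_{d,k}$, and it is not confined in $\mathcal N_{d,k}$. -/

import Mathlib

open MeasureTheory Topology
open scoped Pointwise

/-! ## The rooted tree, its ends, and almost automorphisms -/

namespace Neretin

/-- Vertices of the rooted tree whose root `none` has `k` children, and all of whose other vertices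
have `d` children: `some (i, w)` is reached from the root by following the `i`-th edge
and then the edges listed in `w`. -/
abbrev Vertex (d k : ℕ) : Type := Option (Fin k × List (Fin d))

/-- `IsChild u v`: the vertex `v` is a child of `u`; these are the edges of the tree. -/
inductive IsChild {d k : ℕ} : Vertex d k → Vertex d k → Prop
  | root (i : Fin k) : IsChild none (some (i, []))
  | step (i : Fin k) (w : List (Fin d)) (a : Fin d) : IsChild (some (i, w)) (some (i, w ++ [a]))

/-- Distance to the root. -/
def level {d k : ℕ} : Vertex d k → ℕ
  | none => 0
  | some (_, w) => w.length + 1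

/-- The ends of the tree (infinite geodesic rays from the root), with the product topology
of the discrete topologies. -/
abbrev Ends (d k : ℕ) : Type := Fin k × (ℕ → Fin d)

/-- The vertex at distance `n` from the root on the ray `ξ`. -/
def Ends.vertexAt {d k : ℕ} (ξ : Ends d k) : ℕ → Vertex d k
  | 0 => none
  | n + 1 => some (ξ.1, (List.range n).map ξ.2)

/-- The set of ends of the subtree of all vertices separated from the root by `v`. -/
def shadow {d k : ℕ} (v : Vertex d k) : Set (Ends d k) := {ξ | ∃ n, ξ.vertexAt n = v}

/-- A finite subtree containing the root, given by its vertices. -/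
structure FiniteSubtree (d k : ℕ) where
  verts : Finset (Vertex d k)
  root_mem : none ∈ verts
  parent_mem : ∀ u v : Vertex d k, IsChild u v → v ∈ verts → u ∈ verts

/-- An almost automorphism `(A, B, φ)`: two finite subtrees `A`, `B` containing the root and an
isomorphism of (rooted) forests `φ` from the complement of `A` to the complement of `B`.
The roots of the trees of the forest are the vertices next to `A` (resp. `B`), so the
existence of `φ` forces `A` and `B` to have equally many boundary vertices. -/
structure AlmostAut (d k : ℕ) where
  A : FiniteSubtree d k
  B : FiniteSubtree d k
  φ : {v : Vertex d k // v ∉ A.verts} ≃ {v : Vertex d k // v ∉ B.verts}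
  isChild_iff : ∀ u v, IsChild (φ u).1 (φ v).1 ↔ IsChild u.1 v.1

/-- `g` is the homeomorphism of the space of ends induced by the almost automorphism `a`:
for every vertex `v` outside `A` it maps the ends of the subtree at `v` onto those of the
subtree at `φ v`. -/
def AlmostAut.Induces {d k : ℕ} (a : AlmostAut d k) (g : Ends d k ≃ₜ Ends d k) : Prop :=
  ∀ v : {v : Vertex d k // v ∉ a.A.verts}, g '' shadow v.1 = shadow (a.φ v).1

/-- `LeftOf u v`: in the plane tree (where the children of each vertex are ordered from left to
right as in `Fin k`, resp. `Fin d`), `u` and `v` lie on different branches and `u` is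
to the left of `v`. -/
def LeftOf {d k : ℕ} : Vertex d k → Vertex d k → Prop
  | some (i, w), some (j, w') =>
      i < j ∨ (i = j ∧ ∃ (p s t : List (Fin d)) (a b : Fin d),
        a < b ∧ w = p ++ a :: s ∧ w' = p ++ b :: t)
  | _, _ => False

/-- The forest isomorphism `φ` preserves the left-to-right order of the plane tree. -/
def AlmostAut.OrderPreserving {d k : ℕ} (a : AlmostAut d k) : Prop :=
  ∀ u v, LeftOf (a.φ u).1 (a.φ v).1 ↔ LeftOf u.1 v.1

/-! ### Elementary facts -/

section Basic

variable {d k : ℕ}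

theorem IsChild.level_eq {u v : Vertex d k} (h : IsChild u v) : level v = level u + 1 := by
  cases h <;> simp [level]

theorem IsChild.parent_unique {u u' v : Vertex d k} (h : IsChild u v) (h' : IsChild u' v) :
    u = u' := by
  cases h with
  | root i =>
    generalize hv : (some (i, []) : Vertex d k) = v at h'
    cases h' with
    | root => rfl
    | step => simp at hv
  | step i w a =>
    generalize hv : (some (i, w ++ [a]) : Vertex d k) = v at h'
    cases h' with
    | root => simp at hv
    | step j w' b =>
      simp only [Option.some.injEq, Prod.mk.injEq] at hv
      obtain ⟨rfl, hv⟩ := hv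
      obtain ⟨rfl, -⟩ := List.append_inj' hv rfl
      rfl

theorem exists_parent {v : Vertex d k} (h : v ≠ none) : ∃ u, IsChild u v := by
  rcases v with _ | ⟨i, w⟩
  · exact absurd rfl h
  · rcases List.eq_nil_or_concat w with rfl | ⟨w, a, rfl⟩
    · exact ⟨_, IsChild.root i⟩
    · simpa using ⟨_, IsChild.step i w a⟩

theorem level_vertexAt (ξ : Ends d k) (n : ℕ) : level (ξ.vertexAt n) = n := by
  cases n <;> simp [Ends.vertexAt, level]

theorem isChild_vertexAt (ξ : Ends d k) (n : ℕ) :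
    IsChild (ξ.vertexAt n) (ξ.vertexAt (n + 1)) := by
  cases n with
  | zero => exact IsChild.root _
  | succ n =>
    simp only [Ends.vertexAt, List.range_succ, List.map_append, List.map_cons, List.map_nil]
    exact IsChild.step _ _ _

theorem vertexAt_eq_of_le {ξ η : Ends d k} {n : ℕ} (h : ξ.vertexAt n = η.vertexAt n) :
    ∀ i ≤ n, ξ.vertexAt i = η.vertexAt i := by
  induction n with
  | zero => intro i hi; obtain rfl : i = 0 := by omega
            exact h
  | succ n ih =>
    intro i hi
    rcases Nat.lt_or_ge n i with hlt | hle
    · obtain rfl : i = n + 1 := by omega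
      exact h
    · refine ih ?_ i hle
      have h1 := isChild_vertexAt ξ n
      rw [h] at h1
      exact h1.parent_unique (isChild_vertexAt η n)

theorem mem_shadow_vertexAt {ξ η : Ends d k} {n : ℕ} :
    η ∈ shadow (ξ.vertexAt n) ↔ η.vertexAt n = ξ.vertexAt n := by
  constructor
  · rintro ⟨m, hm⟩
    have := congrArg level hm
    rw [level_vertexAt, level_vertexAt] at this
    rwa [← this] at hm ⊢
  · intro h
    exact ⟨n, h⟩

theorem FiniteSubtree.mem_of_le (B : FiniteSubtree d k) (ξ : Ends d k) {i j : ℕ} (hij : i ≤ j)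
    (hj : ξ.vertexAt j ∈ B.verts) : ξ.vertexAt i ∈ B.verts := by
  induction j with
  | zero => obtain rfl : i = 0 := by omega
            exact hj
  | succ j ih =>
    rcases Nat.lt_or_ge j i with hlt | hle
    · obtain rfl : i = j + 1 := by omega
      exact hj
    · exact ih hle (B.parent_mem _ _ (isChild_vertexAt ξ j) hj)

theorem FiniteSubtree.exists_exit (B : FiniteSubtree d k) (ξ : Ends d k) :
    ∃ j, ξ.vertexAt j ∈ B.verts ∧ ξ.vertexAt (j + 1) ∉ B.verts := by
  by_contra! hcon
  have hall : ∀ n, ξ.vertexAt n ∈ B.verts := by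
    intro n
    induction n with
    | zero => exact B.root_mem
    | succ n ih => exact hcon n ih
  have hinj : Function.Injective (fun n => (⟨ξ.vertexAt n, hall n⟩ : B.verts)) := by
    intro m n h
    have := congrArg (fun v => level v.1) h
    simpa [level_vertexAt] using this
  exact not_injective_infinite_finite _ hinj

/-- The union of two finite subtrees. -/
def FiniteSubtree.union (A B : FiniteSubtree d k) : FiniteSubtree d k where
  verts := A.verts ∪ B.verts
  root_mem := Finset.mem_union_left _ A.root_mem
  parent_mem u v h hv := by
    rcases Finset.mem_union.1 hv with hv | hv
    · exact Finset.mem_union_left _ (A.parent_mem u v h hv)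
    · exact Finset.mem_union_right _ (B.parent_mem u v h hv)

/-- The identity, as an almost automorphism. -/
def AlmostAut.refl (d k : ℕ) : AlmostAut d k where
  A := ⟨{none}, by simp, by
    intro u v h hv
    obtain rfl := Finset.mem_singleton.1 hv
    cases h⟩
  B := ⟨{none}, by simp, by
    intro u v h hv
    obtain rfl := Finset.mem_singleton.1 hv
    cases h⟩
  φ := Equiv.refl _
  isChild_iff _ _ := Iff.rfl

/-- The inverse almost automorphism. -/
def AlmostAut.symm (a : AlmostAut d k) : AlmostAut d k where
  A := a.B
  B := a.A
  φ := a.φ.symm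
  isChild_iff u v := by simpa using (a.isChild_iff (a.φ.symm u) (a.φ.symm v)).symm

theorem AlmostAut.Induces.symm {a : AlmostAut d k} {g : Ends d k ≃ₜ Ends d k}
    (h : a.Induces g) : a.symm.Induces g⁻¹ := by
  intro (v : {v : Vertex d k // v ∉ a.B.verts})
  have h1 := h (a.φ.symm v)
  rw [Equiv.apply_symm_apply] at h1
  change g.symm '' shadow v.1 = shadow (a.φ.symm v).1
  rw [← h1, ← Set.image_comp]
  simp

theorem AlmostAut.OrderPreserving.symm {a : AlmostAut d k} (h : a.OrderPreserving) :
    a.symm.OrderPreserving := by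
  intro (u : {v : Vertex d k // v ∉ a.B.verts}) (v : {v : Vertex d k // v ∉ a.B.verts})
  change LeftOf (a.φ.symm u).1 (a.φ.symm v).1 ↔ _
  simpa using (h (a.φ.symm u) (a.φ.symm v)).symm

/-- Every almost automorphism can be represented with a larger source subtree. -/
theorem AlmostAut.exists_restrict (a : AlmostAut d k) (C : FiniteSubtree d k)
    (hC : a.A.verts ⊆ C.verts) : ∃ a' : AlmostAut d k, a'.A = C ∧
      (∀ g, a.Induces g → a'.Induces g) ∧ (a.OrderPreserving → a'.OrderPreserving) := by
  classical
  let S : Finset (Vertex d k) := a.B.verts ∪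
    (C.verts.subtype (fun v => v ∉ a.A.verts)).image (fun v => (a.φ v).1)
  have hS : ∀ w, w ∉ S ↔ ∃ hw : w ∉ a.B.verts, (a.φ.symm ⟨w, hw⟩).1 ∉ C.verts := by
    intro w
    simp only [S, Finset.mem_union, Finset.mem_image, Finset.mem_subtype, not_or, not_exists,
      not_and]
    constructor
    · rintro ⟨h1, h2⟩
      refine ⟨h1, fun h3 => h2 _ h3 (by simp)⟩
    · rintro ⟨h1, h2⟩
      refine ⟨h1, ?_⟩
      rintro v hv rfl
      exact h2 (by simpa using hv)
  let D : FiniteSubtree d k :=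
    { verts := S
      root_mem := Finset.mem_union_left _ a.B.root_mem
      parent_mem := by
        intro u v huv hv
        by_contra hu
        obtain ⟨hu1, hu2⟩ := (hS u).1 hu
        have hv1 : v ∉ a.B.verts := fun h => hu1 (a.B.parent_mem _ _ huv h)
        refine (hS v).2 ⟨hv1, fun h => hu2 (C.parent_mem _ _ ?_ h)⟩ hv
        exact (a.symm.isChild_iff ⟨u, hu1⟩ ⟨v, hv1⟩).2 huv }
  refine ⟨⟨C, D,
    { toFun := fun v => ⟨(a.φ ⟨v.1, fun h => v.2 (hC h)⟩).1, (hS _).2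
        ⟨(a.φ ⟨v.1, fun h => v.2 (hC h)⟩).2, by simpa using v.2⟩⟩
      invFun := fun w => ⟨(a.φ.symm ⟨w.1, ((hS _).1 w.2).1⟩).1, ((hS _).1 w.2).2⟩
      left_inv := fun v => by simp
      right_inv := fun w => by simp }, ?_⟩, rfl, ?_, ?_⟩
  · intro u v
    exact a.isChild_iff _ _
  · intro g hg v
    exact hg ⟨v.1, fun h => v.2 (hC h)⟩
  · intro ho u v
    exact ho _ _

/-- Composition of almost automorphisms with matching subtrees. -/
theorem AlmostAut.exists_trans (a b : AlmostAut d k) (h : b.A = a.B) : ∃ c : AlmostAut d k,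
    (∀ g g', a.Induces g → b.Induces g' → c.Induces (g' * g)) ∧
    (a.OrderPreserving → b.OrderPreserving → c.OrderPreserving) := by
  obtain ⟨A, B, φ, hφ⟩ := a
  obtain ⟨A', B', φ', hφ'⟩ := b
  obtain rfl : A' = B := h
  refine ⟨⟨A, B', φ.trans φ', fun u v => (hφ' _ _).trans (hφ u v)⟩, ?_, ?_⟩
  · intro g g' hg hg' v
    have e : ⇑(g' * g) = g' ∘ g := rfl
    rw [e, Set.image_comp]
    exact (congrArg _ (hg v)).trans (hg' (φ v))
  · intro ho ho' u v
    exact (ho' _ _).trans (ho u v)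

theorem AlmostAut.exists_comp (a b : AlmostAut d k) : ∃ c : AlmostAut d k,
    (∀ g g', a.Induces g → b.Induces g' → c.Induces (g' * g)) ∧
    (a.OrderPreserving → b.OrderPreserving → c.OrderPreserving) := by
  obtain ⟨a', ha, hai, hao⟩ :=
    a.symm.exists_restrict (a.B.union b.A) Finset.subset_union_left
  obtain ⟨b', hb, hbi, hbo⟩ := b.exists_restrict (a.B.union b.A) Finset.subset_union_right
  obtain ⟨c, hc, hco⟩ := a'.symm.exists_trans b' (by rw [hb]; exact ha.symm)
  refine ⟨c, fun g g' hg hg' => hc g g' ?_ (hbi _ hg'), fun ho ho' => hco ?_ (hbo ho')⟩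
  · simpa using (hai _ hg.symm).symm
  · exact (hao ho.symm).symm

theorem AlmostAut.refl_induces : (AlmostAut.refl d k).Induces 1 := by
  intro v
  exact Set.image_id _

end Basic

end Neretin

/-! ## The Neretin group and Thompson's group -/

/-- The Neretin group, as the group of all homeomorphisms of the space of ends that are induced by
almost automorphisms. Two almost automorphisms induce the same homeomorphism if and
only if they agree outside a finite subtree (for `d ≥ 2`). -/
def NeretinGroup (d k : ℕ) : Subgroup (Neretin.Ends d k ≃ₜ Neretin.Ends d k) where
  carrier := {g | ∃ a : Neretin.AlmostAut d k, a.Induces g}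
  one_mem' := ⟨_, Neretin.AlmostAut.refl_induces⟩
  mul_mem' := by
    rintro g g' ⟨a, ha⟩ ⟨b, hb⟩
    obtain ⟨c, hc, -⟩ := b.exists_comp a
    exact ⟨c, hc _ _ hb ha⟩
  inv_mem' := by
    rintro g ⟨a, ha⟩
    exact ⟨_, ha.symm⟩

/-- The elements of the Neretin group that have an order-preserving representative. -/
def ThompsonF (d k : ℕ) : Subgroup (NeretinGroup d k) where
  carrier := {g | ∃ a : Neretin.AlmostAut d k, a.OrderPreserving ∧ a.Induces g.1}
  one_mem' := ⟨_, fun _ _ => Iff.rfl, Neretin.AlmostAut.refl_induces⟩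
  mul_mem' := by
    rintro g g' ⟨a, hao, ha⟩ ⟨b, hbo, hb⟩
    obtain ⟨c, hc, hco⟩ := b.exists_comp a
    exact ⟨c, hco hbo hao, hc _ _ hb ha⟩
  inv_mem' := by
    rintro g ⟨a, hao, ha⟩
    exact ⟨_, hao.symm, ha.symm⟩

namespace Neretin

variable {d k : ℕ}

/-- The Neretin group acts on the space of ends by evaluation. -/
instance : MulAction (NeretinGroup d k) (Ends d k) where
  smul g ξ := g.1 ξ
  one_smul _ := rfl
  mul_smul _ _ _ := rfl

instance : ContinuousConstSMul (NeretinGroup d k) (Ends d k) where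
  continuous_const_smul g := g.1.continuous

/-- The group of automorphisms of the rooted tree. -/
abbrev TreeAut (d k : ℕ) : Type :=
  (IsChild : Vertex d k → Vertex d k → Prop) ≃r (IsChild : Vertex d k → Vertex d k → Prop)

/-- `g` is the homeomorphism of the space of ends induced by the tree automorphism `ψ`. -/
def TreeAut.Induces (ψ : TreeAut d k) (g : Ends d k ≃ₜ Ends d k) : Prop :=
  ∀ v : Vertex d k, g '' shadow v = shadow (ψ v)

theorem TreeAut.Induces.mem_iff {ψ : TreeAut d k} {g : Ends d k ≃ₜ Ends d k} (h : ψ.Induces g)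
    (v : Vertex d k) (ξ : Ends d k) : g ξ ∈ shadow (ψ v) ↔ ξ ∈ shadow v := by
  rw [← h v, g.injective.mem_set_image]

theorem TreeAut.Induces.mul {ψ χ : TreeAut d k} {g h : Ends d k ≃ₜ Ends d k}
    (hg : ψ.Induces g) (hh : χ.Induces h) : (ψ * χ : TreeAut d k).Induces (g * h) := by
  intro v
  have e : ⇑(g * h) = g ∘ h := rfl
  rw [e, Set.image_comp, hh v, hg (χ v)]
  rfl

theorem TreeAut.Induces.inv {ψ : TreeAut d k} {g : Ends d k ≃ₜ Ends d k}
    (hg : ψ.Induces g) : (ψ⁻¹ : TreeAut d k).Induces g⁻¹ := by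
  intro v
  have h1 := hg (ψ.symm v)
  rw [RelIso.apply_symm_apply] at h1
  change g.symm '' shadow v = shadow (ψ.symm v)
  rw [← h1, ← Set.image_comp]
  simp

/-- The subgroup of the Neretin group formed by the automorphisms of the rooted tree that fix all
vertices at distance at most `n` from the root. For `n = 0` this is the whole automorphism
group of the rooted tree. -/
def levelStab (d k n : ℕ) : Subgroup (NeretinGroup d k) where
  carrier := {g | ∃ ψ : TreeAut d k, (∀ v, level v ≤ n → ψ v = v) ∧ ψ.Induces g.1}
  one_mem' := ⟨1, fun _ _ => rfl, fun _ => Set.image_id _⟩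
  mul_mem' := by
    rintro g h ⟨ψ, hψ, hg⟩ ⟨χ, hχ, hh⟩
    refine ⟨ψ * χ, fun v hv => ?_, hg.mul hh⟩
    rw [RelIso.mul_apply, hχ v hv, hψ v hv]
  inv_mem' := by
    rintro g ⟨ψ, hψ, hg⟩
    refine ⟨ψ⁻¹, fun v hv => ?_, hg.inv⟩
    change ψ.symm v = v
    rw [RelIso.symm_apply_eq, hψ v hv]

theorem levelStab_anti {m n : ℕ} (h : m ≤ n) : levelStab d k n ≤ levelStab d k m := by
  rintro g ⟨ψ, hψ, hg⟩
  exact ⟨ψ, fun v hv => hψ v (hv.trans h), hg⟩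

theorem finite_level_le (d k n : ℕ) : {v : Vertex d k | level v ≤ n}.Finite := by
  have h : {w : List (Fin d) | w.length ≤ n}.Finite := List.finite_length_le _ _
  refine (((Set.finite_univ (α := Fin k)).prod h).image some |>.insert none).subset ?_
  rintro (_ | ⟨i, w⟩) hv
  · exact Or.inl rfl
  · refine Or.inr ⟨(i, w), ⟨trivial, ?_⟩, rfl⟩
    simp only [level, Set.mem_ofPred_eq] at hv ⊢
    omega

open Classical in
/-- Conjugating a tree automorphism that fixes the subtree `A` and its neighbours by `(A, B, φ)`. -/
noncomputable def conjFun (a : AlmostAut d k) (ψ : TreeAut d k) (u : Vertex d k) : Vertex d k :=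
  if hu : u ∈ a.B.verts then u else
    if h : ψ (a.φ.symm ⟨u, hu⟩).1 ∈ a.A.verts then u else (a.φ ⟨_, h⟩).1

section Conj

variable (a : AlmostAut d k) (m : ℕ)

theorem notMem_of_fix (hm : ∀ v ∈ a.A.verts, level v < m) {ψ : TreeAut d k} (hψ : ∀ v, level v ≤ m → ψ v = v) {v : Vertex d k}
    (hv : v ∉ a.A.verts) : ψ v ∉ a.A.verts := by
  intro h
  have := hψ _ (hm _ h).le
  exact hv (ψ.injective this ▸ h)

theorem conjFun_of_notMem (hm : ∀ v ∈ a.A.verts, level v < m) {ψ : TreeAut d k} (hψ : ∀ v, level v ≤ m → ψ v = v)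
    {u : Vertex d k} (hu : u ∉ a.B.verts) :
    conjFun a ψ u = (a.φ ⟨ψ (a.φ.symm ⟨u, hu⟩).1,
      notMem_of_fix a m hm hψ (a.φ.symm ⟨u, hu⟩).2⟩).1 := by
  rw [conjFun, dif_neg hu, dif_neg]

theorem conjFun_of_mem (ψ : TreeAut d k) {u : Vertex d k} (hu : u ∈ a.B.verts) :
    conjFun a ψ u = u := by
  rw [conjFun, dif_pos hu]

theorem conjFun_notMem (hm : ∀ v ∈ a.A.verts, level v < m) {ψ : TreeAut d k} (hψ : ∀ v, level v ≤ m → ψ v = v)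
    {u : Vertex d k} (hu : u ∉ a.B.verts) : conjFun a ψ u ∉ a.B.verts := by
  rw [conjFun_of_notMem a m hm hψ hu]
  exact (a.φ _).2

theorem conjFun_conjFun (hm : ∀ v ∈ a.A.verts, level v < m) {ψ χ : TreeAut d k} (hψ : ∀ v, level v ≤ m → ψ v = v)
    (hχ : ∀ v, level v ≤ m → χ v = v) (h : ∀ v, χ (ψ v) = v) (u : Vertex d k) :
    conjFun a χ (conjFun a ψ u) = u := by
  by_cases hu : u ∈ a.B.verts
  · rw [conjFun_of_mem a ψ hu, conjFun_of_mem a χ hu]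
  · rw [conjFun_of_notMem a m hm hχ (conjFun_notMem a m hm hψ hu)]
    simp [conjFun_of_notMem a m hm hψ hu, h]

/-- The vertices next to `B` are fixed. -/
theorem conjFun_of_parent_mem (hm : ∀ v ∈ a.A.verts, level v < m) {ψ : TreeAut d k} (hψ : ∀ v, level v ≤ m → ψ v = v)
    {u u' : Vertex d k} (hu : u ∉ a.B.verts) (hu' : u' ∈ a.B.verts) (h : IsChild u' u) :
    conjFun a ψ u = u := by
  have hne : (a.φ.symm ⟨u, hu⟩).1 ≠ none := fun h0 =>
    (a.φ.symm ⟨u, hu⟩).2 (h0 ▸ a.A.root_mem)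
  obtain ⟨p, hp⟩ := exists_parent hne
  have hpA : p ∈ a.A.verts := by
    by_contra hpA
    have h1 := (a.isChild_iff ⟨p, hpA⟩ (a.φ.symm ⟨u, hu⟩)).2 hp
    rw [Equiv.apply_symm_apply] at h1
    exact (a.φ ⟨p, hpA⟩).2 (h.parent_unique h1 ▸ hu')
  have hl : level (a.φ.symm ⟨u, hu⟩).1 ≤ m := by
    rw [hp.level_eq]
    exact hm p hpA
  rw [conjFun_of_notMem a m hm hψ hu]
  simp [hψ _ hl]

theorem isChild_conjFun (hm : ∀ v ∈ a.A.verts, level v < m) {ψ : TreeAut d k} (hψ : ∀ v, level v ≤ m → ψ v = v)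
    {u' u : Vertex d k} (h : IsChild u' u) : IsChild (conjFun a ψ u') (conjFun a ψ u) := by
  by_cases hu' : u' ∈ a.B.verts
  · rw [conjFun_of_mem a ψ hu']
    by_cases hu : u ∈ a.B.verts
    · rwa [conjFun_of_mem a ψ hu]
    · rwa [conjFun_of_parent_mem a m hm hψ hu hu' h]
  · have hu : u ∉ a.B.verts := fun h1 => hu' (a.B.parent_mem _ _ h h1)
    rw [conjFun_of_notMem a m hm hψ hu, conjFun_of_notMem a m hm hψ hu', a.isChild_iff]
    exact ψ.map_rel_iff.2 ((a.symm.isChild_iff ⟨u', hu'⟩ ⟨u, hu⟩).2 h)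

theorem conj_mem_shadow (hm : ∀ v ∈ a.A.verts, level v < m) {g h : Ends d k ≃ₜ Ends d k} (hg : a.Induces g) {ψ : TreeAut d k}
    (hψ : ∀ v, level v ≤ m → ψ v = v) (hh : ψ.Induces h) (u : Vertex d k) {ξ : Ends d k}
    (hξ : ξ ∈ shadow u) : g (h (g.symm ξ)) ∈ shadow (conjFun a ψ u) := by
  have key : ∀ u ∉ a.B.verts, ξ ∈ shadow u → g (h (g.symm ξ)) ∈ shadow (conjFun a ψ u) := by
    intro u hu hξ
    rw [conjFun_of_notMem a m hm hψ hu, ← hg]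
    refine Set.mem_image_of_mem _ ((hh.mem_iff _ _).2 ?_)
    have h1 := hg (a.φ.symm ⟨u, hu⟩)
    rw [Equiv.apply_symm_apply] at h1
    rw [← h1] at hξ
    obtain ⟨η, hη, rfl⟩ := hξ
    simpa using hη
  by_cases hu : u ∈ a.B.verts
  · rw [conjFun_of_mem a ψ hu]
    obtain ⟨i, rfl⟩ := hξ
    obtain ⟨j, hj, hj'⟩ := a.B.exists_exit ξ
    have h1 := key _ hj' ⟨_, rfl⟩
    rw [conjFun_of_parent_mem a m hm hψ hj' hj (isChild_vertexAt ξ j), mem_shadow_vertexAt] at h1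
    refine ⟨i, vertexAt_eq_of_le h1 i ?_⟩
    by_contra hlt
    exact hj' (a.B.mem_of_le ξ (by omega) hu)
  · exact key u hu hξ

end Conj

theorem exists_levelStab_conj (g : NeretinGroup d k) (n : ℕ) :
    ∃ m, ∀ h ∈ levelStab d k m, g * h * g⁻¹ ∈ levelStab d k n := by
  classical
  obtain ⟨g, a, ha⟩ := g
  obtain ⟨m, hm⟩ : ∃ m, ∀ v ∈ a.A.verts ∪ ((finite_level_le d k n).toFinset.subtype
      (fun v => v ∉ a.B.verts)).image (fun v => (a.φ.symm v).1), level v < m :=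
    ⟨_, fun v hv => Nat.lt_succ_of_le (Finset.le_sup (f := level) hv)⟩
  have hmA : ∀ v ∈ a.A.verts, level v < m := fun v hv => hm v (Finset.mem_union_left _ hv)
  have hmn : ∀ v (hv : v ∉ a.B.verts), level v ≤ n → level (a.φ.symm ⟨v, hv⟩).1 ≤ m := by
    intro v hv hn
    refine (hm _ (Finset.mem_union_right _ (Finset.mem_image.2 ⟨⟨v, hv⟩, ?_, rfl⟩))).le
    simpa using hn
  refine ⟨m, ?_⟩
  rintro ⟨h, hN⟩ ⟨ψ, hψ, hh⟩
  have hψ' : ∀ v, level v ≤ m → ψ.symm v = v := by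
    intro v hv
    rw [RelIso.symm_apply_eq, hψ v hv]
  let Ψ : TreeAut d k :=
    { toFun := conjFun a ψ
      invFun := conjFun a ψ.symm
      left_inv := conjFun_conjFun a m hmA hψ hψ' (by simp)
      right_inv := conjFun_conjFun a m hmA hψ' hψ (by simp)
      map_rel_iff' := by
        intro u v
        refine ⟨fun h1 => ?_, isChild_conjFun a m hmA hψ⟩
        have h2 := isChild_conjFun a m hmA hψ' h1
        simpa [conjFun_conjFun a m hmA hψ hψ'] using h2 }
  refine ⟨Ψ, fun v hv => ?_, fun v => ?_⟩
  · by_cases hvB : v ∈ a.B.verts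
    · exact conjFun_of_mem a ψ hvB
    · refine (conjFun_of_notMem a m hmA hψ hvB).trans ?_
      simp [hψ _ (hmn v hvB hv)]
  · refine Set.Subset.antisymm ?_ ?_
    · rintro _ ⟨ξ, hξ, rfl⟩
      exact conj_mem_shadow a m hmA ha hψ hh v hξ
    · intro ξ hξ
      have h1 := conj_mem_shadow a m hmA ha hψ' hh.inv _ hξ
      have h2 : conjFun a ψ.symm (Ψ v) = v := conjFun_conjFun a m hmA hψ hψ' (by simp) v
      rw [h2] at h1
      refine ⟨_, h1, ?_⟩
      change g (h (g.symm (g (h.symm (g.symm ξ))))) = ξ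
      simp

/-- The subgroups `levelStab d k n` as a basis of neighbourhoods of the identity. -/
@[reducible] def groupFilterBasis (d k : ℕ) : GroupFilterBasis (NeretinGroup d k) where
  sets := Set.range fun n => (levelStab d k n : Set (NeretinGroup d k))
  nonempty := ⟨_, 0, rfl⟩
  inter_sets := by
    rintro _ _ ⟨m, rfl⟩ ⟨n, rfl⟩
    exact ⟨_, ⟨max m n, rfl⟩, Set.subset_inter (levelStab_anti (le_max_left _ _))
      (levelStab_anti (le_max_right _ _))⟩
  one' := by
    rintro _ ⟨n, rfl⟩
    exact one_mem _
  mul' := by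
    rintro _ ⟨n, rfl⟩
    exact ⟨_, ⟨n, rfl⟩, by rw [coe_mul_coe]⟩
  inv' := by
    rintro _ ⟨n, rfl⟩
    exact ⟨_, ⟨n, rfl⟩, fun g hg => inv_mem hg⟩
  conj' := by
    rintro g _ ⟨n, rfl⟩
    obtain ⟨m, hm⟩ := exists_levelStab_conj g n
    exact ⟨_, ⟨m, rfl⟩, hm⟩

/-- The group topology of the Neretin group, for which the profinite group of automorphisms of the
rooted tree (with the topology of pointwise convergence on vertices) is an open subgroup. -/
instance : TopologicalSpace (NeretinGroup d k) := (groupFilterBasis d k).topology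

instance : IsTopologicalGroup (NeretinGroup d k) := (groupFilterBasis d k).isTopologicalGroup

end Neretin

/-! ## Chabauty space, confined subgroups, and the class attached to an action -/

section Confined

variable {G : Type*} [Group G] [TopologicalSpace G]

/-- The Chabauty topology on the space of closed subgroups. -/
instance chabautyTopology (G : Type*) [Group G] [TopologicalSpace G] :
    TopologicalSpace (ClosedSubgroup G) :=
  TopologicalSpace.generateFrom
    ({S | ∃ C : Set G, IsCompact C ∧ S = {K : ClosedSubgroup G | (K : Set G) ∩ C = ∅}} ∪
     {S | ∃ U : Set G, IsOpen U ∧ S = {K : ClosedSubgroup G | ((K : Set G) ∩ U).Nonempty}})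

/-- The conjugacy class of a closed subgroup. -/
def conjugacyClass (H : ClosedSubgroup G) : Set (ClosedSubgroup G) :=
  {K | ∃ g : G, K.toSubgroup = H.toSubgroup.map (MulAut.conj g).toMonoidHom}

/-- A closed subgroup is confined if the closure of its conjugacy class in the Chabauty space
does not contain the trivial subgroup. -/
def IsConfined (H : ClosedSubgroup G) : Prop :=
  ∀ K ∈ closure (conjugacyClass H), K.toSubgroup ≠ ⊥

/-- The set `𝒮_X` of all closed subgroups `H` of `G` such that for every non-empty clopen subset `α`
of `X`, the (setwise) stabilizer of `α` in `H` fixes a (regular Borel) probability measure on `α`. -/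
def piecewiseFixingMeasure (G X : Type*) [Group G] [TopologicalSpace G] [TopologicalSpace X]
    [MeasurableSpace X] [BorelSpace X] [MulAction G X] [ContinuousConstSMul G X] : Set (ClosedSubgroup G) :=
  {H | ∀ α : Set X, IsClopen α → α.Nonempty →
    ∃ μ : Measure X, IsProbabilityMeasure μ ∧ μ.Regular ∧ μ αᶜ = 0 ∧
      ∀ h ∈ H, h • α = α → μ.map (fun x => h • x) = μ}

end Confined

namespace Neretin

variable {d k : ℕ}

/-! ## The lexicographic order on the ends -/

/-! Everything rests on the fact that Thompson's group F preserves the lexicographic order `EndLT`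
of the ends (`endLT_map_of_mem_thompsonF`).

Discreteness: a tree automorphism in F acts on each level, a finite linear order, by a strictly
monotone map, hence trivially. So F meets an open subgroup only in the identity
(`thompsonF_inf_levelStab`); being discrete in a Hausdorff group, it is closed. Invariant measures:
a non-empty clopen set has a leftmost end, which its stabilizer in F must fix, so the Dirac measure
there is invariant.

Non-confinement: by `mem_closure_of_forall_isCompact` it suffices that every compact set C without
the identity is missed by some conjugate of F. By compactness there is an L such that each element
of C maps a subtree with root of level at most L isomorphically onto a disjoint one
(`exists_forall_movesSubtree`). The conjugate g⁻¹Fg preserves the order pulled back along g.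
Permuting the vertices of a deep level gives a g for which disjoint subtrees of that size are never
isomorphic as ordered trees (`exists_conj_not_movesSubtree`). They are told apart by the least
positive relative depth at which an initial segment is a subtree, computed in
`exists_initial_depth`; markers of widely spaced lengths make these depths differ. -/

/-- The vertices at distance `M + 1` from the root, in lexicographic order. -/
abbrev LexWord (d k M : ℕ) : Type := Fin k ×ₗ Lex (Fin M → Fin d)

/-- The vertex at distance `M + 1` from the root on the ray `x`, as a lexicographic word. -/
def Ends.trunc (M : ℕ) (x : Ends d k) : LexWord d k M := toLex (x.1, toLex fun i => x.2 i)

theorem trunc_eq_iff {M : ℕ} {x y : Ends d k} :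
    x.trunc M = y.trunc M ↔ x.1 = y.1 ∧ ∀ i < M, x.2 i = y.2 i := by
  simp only [Ends.trunc, toLex_inj, Prod.mk.injEq, funext_iff, Fin.forall_iff]

theorem trunc_lt_iff {M : ℕ} {x y : Ends d k} : x.trunc M < y.trunc M ↔
    x.1 < y.1 ∨ x.1 = y.1 ∧ ∃ i < M, (∀ j < i, x.2 j = y.2 j) ∧ x.2 i < y.2 i := by
  rw [Ends.trunc, Ends.trunc, Prod.Lex.toLex_lt_toLex]
  refine or_congr Iff.rfl (and_congr Iff.rfl ?_)
  change (∃ i : Fin M, (∀ j : Fin M, j < i → x.2 j = y.2 j) ∧ x.2 i < y.2 i) ↔ _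
  constructor
  · rintro ⟨i, h, h'⟩
    exact ⟨i, i.2, fun j hj => h ⟨j, hj.trans i.2⟩ hj, h'⟩
  · rintro ⟨i, hi, h, h'⟩
    exact ⟨⟨i, hi⟩, fun j hj => h j hj, h'⟩

theorem vertexAt_succ_eq_iff {M : ℕ} {x y : Ends d k} :
    x.vertexAt (M + 1) = y.vertexAt (M + 1) ↔ x.1 = y.1 ∧ ∀ i < M, x.2 i = y.2 i := by
  simp [Ends.vertexAt]

theorem vertexAt_succ_eq_iff_trunc {M : ℕ} {x y : Ends d k} :
    x.vertexAt (M + 1) = y.vertexAt (M + 1) ↔ x.trunc M = y.trunc M := by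
  rw [vertexAt_succ_eq_iff, trunc_eq_iff]

theorem exists_vertexAt_ne {x y : Ends d k} (h : x ≠ y) : ∃ n, x.vertexAt n ≠ y.vertexAt n := by
  by_contra! hc
  refine h (Prod.ext (vertexAt_succ_eq_iff.1 (hc 1)).1 (funext fun i => ?_))
  exact (vertexAt_succ_eq_iff.1 (hc (i + 2))).2 i (by omega)

theorem trunc_lt_mono {M N : ℕ} (hMN : M ≤ N) {x y : Ends d k} (h : x.trunc M < y.trunc M) :
    x.trunc N < y.trunc N := by
  rw [trunc_lt_iff] at h ⊢
  rcases h with h | ⟨h, i, hi, h'⟩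
  · exact Or.inl h
  · exact Or.inr ⟨h, i, hi.trans_le hMN, h'⟩

/-- The lexicographic order of the ends. -/
def EndLT (x y : Ends d k) : Prop := ∃ M, x.trunc M < y.trunc M

theorem EndLT.trans {x y z : Ends d k} (h : EndLT x y) (h' : EndLT y z) : EndLT x z := by
  obtain ⟨M, h⟩ := h
  obtain ⟨N, h'⟩ := h'
  exact ⟨max M N, (trunc_lt_mono (le_max_left _ _) h).trans (trunc_lt_mono (le_max_right _ _) h')⟩

theorem EndLT.irrefl (x : Ends d k) : ¬ EndLT x x := fun ⟨_, h⟩ => lt_irrefl _ h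

theorem EndLT.asymm {x y : Ends d k} (h : EndLT x y) : ¬ EndLT y x :=
  fun h' => EndLT.irrefl _ (h.trans h')

theorem EndLT.trichotomy {x y : Ends d k} (h : x ≠ y) : EndLT x y ∨ EndLT y x := by
  obtain ⟨n, hn⟩ := exists_vertexAt_ne h
  cases n with
  | zero => exact absurd rfl hn
  | succ n =>
    rw [Ne, vertexAt_succ_eq_iff_trunc] at hn
    exact (lt_or_gt_of_ne hn).imp (⟨_, ·⟩) (⟨_, ·⟩)

theorem EndLT.trunc_le {x y : Ends d k} (h : EndLT x y) (M : ℕ) : x.trunc M ≤ y.trunc M :=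
  not_lt.1 fun h' => h.asymm ⟨M, h'⟩

theorem isOpen_setOf_vertexAt_eq (x : Ends d k) (n : ℕ) :
    IsOpen {y : Ends d k | y.vertexAt n = x.vertexAt n} := by
  cases n with
  | zero => simp [Ends.vertexAt]
  | succ n =>
    have : {y : Ends d k | y.vertexAt (n + 1) = x.vertexAt (n + 1)} =
        (fun y => y.1) ⁻¹' {x.1} ∩ ⋂ i ∈ Finset.range n, (fun y => y.2 i) ⁻¹' {x.2 i} := by
      ext y
      simp [-Prod.mk.eta, vertexAt_succ_eq_iff]
    rw [this]
    refine ((isOpen_discrete _).preimage continuous_fst).inter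
      (isOpen_biInter_finset fun i _ => (isOpen_discrete _).preimage (by fun_prop))

theorem isOpen_setOf_endLT (y : Ends d k) : IsOpen {x | EndLT y x} := by
  refine isOpen_iff_mem_nhds.2 ?_
  rintro x ⟨M, h⟩
  filter_upwards [(isOpen_setOf_vertexAt_eq x (M + 1)).mem_nhds rfl] with z hz
  exact ⟨M, by rwa [vertexAt_succ_eq_iff_trunc.1 hz]⟩

/-- A non-empty compact set of ends has a leftmost element. -/
theorem exists_leftmost {α : Set (Ends d k)} (hα : IsCompact α) (hne : α.Nonempty) :
    ∃ x ∈ α, ∀ y ∈ α, ¬ EndLT y x := by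
  by_contra! hc
  -- Without a leftmost element, the open sets of ends to the right of some y in α would cover α. In
  -- a finite subcover, a leftmost index y lies in α and so is covered by the set of an index
  -- further left.
  obtain ⟨t, htα, ht⟩ := hα.elim_finite_subcover_image (b := α) (c := fun y => {x | EndLT y x})
    (fun y _ => isOpen_setOf_endLT y) (fun x hx => by
      obtain ⟨y, hy, h⟩ := hc x hx
      exact Set.mem_biUnion hy h)
  obtain ⟨hfin, hcov⟩ := ht
  have hwf : t.WellFoundedOn EndLT := by
    have : IsStrictOrder (Ends d k) EndLT :=
      { irrefl := EndLT.irrefl, trans := fun _ _ _ => EndLT.trans }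
    exact hfin.wellFoundedOn
  have htne : t.Nonempty := by
    obtain ⟨x, hx⟩ := hne
    obtain ⟨y, hy, -⟩ := Set.mem_iUnion₂.1 (hcov hx)
    exact ⟨y, hy⟩
  obtain ⟨⟨y, hy⟩, -, hmin⟩ := hwf.has_min Set.univ ⟨⟨_, htne.some_mem⟩, trivial⟩
  obtain ⟨z, hz, h⟩ := Set.mem_iUnion₂.1 (hcov (htα hy))
  exact hmin ⟨z, hz⟩ trivial h

/-! ## Thompson's group preserves the order -/

/-- Descendants inherit `LeftOf`. Having it for all large levels, chosen independently, allows
vertices outside any given finite subtree. -/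
theorem EndLT.exists_leftOf {x y : Ends d k} (h : EndLT x y) :
    ∃ N, ∀ m n, N ≤ m → N ≤ n → LeftOf (x.vertexAt m) (y.vertexAt n) := by
  obtain ⟨M, h⟩ := h
  refine ⟨M + 1, fun m n hm hn => ?_⟩
  obtain ⟨m, rfl⟩ := Nat.exists_eq_add_of_le' hm
  obtain ⟨n, rfl⟩ := Nat.exists_eq_add_of_le' hn
  rcases trunc_lt_iff.1 h with h | ⟨h, i, hi, h1, h2⟩
  · exact Or.inl h
  · refine Or.inr ⟨h, (List.range i).map x.2,
      (List.range (m + M - (i + 1))).map fun j => x.2 (i + 1 + j),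
      (List.range (n + M - (i + 1))).map fun j => y.2 (i + 1 + j), x.2 i, y.2 i, h2, ?_, ?_⟩
    · obtain ⟨c, hc⟩ := Nat.exists_eq_add_of_le (show i + 1 ≤ m + M by omega)
      change (List.range (m + M)).map x.2 = _
      rw [hc, List.range_add]
      simp [List.range_succ]
    · obtain ⟨c, hc⟩ := Nat.exists_eq_add_of_le (show i + 1 ≤ n + M by omega)
      have e : (List.range i).map x.2 = (List.range i).map y.2 :=
        List.map_congr_left fun j hj => h1 j (List.mem_range.1 hj)
      change (List.range (n + M)).map y.2 = _
      rw [e, hc, List.range_add]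
      simp [List.range_succ]

theorem endLT_of_leftOf {x y : Ends d k} {m n : ℕ} (h : LeftOf (x.vertexAt m) (y.vertexAt n)) :
    EndLT x y := by
  cases m with
  | zero => exact h.elim
  | succ m =>
    cases n with
    | zero => exact h.elim
    | succ n =>
      rcases h with h | ⟨h, p, s, t, a, b, hab, hx, hy⟩
      · exact ⟨0, trunc_lt_iff.2 (Or.inl h)⟩
      · have key : ∀ (z : ℕ → Fin d) (l : ℕ) (c : Fin d) (q : List (Fin d)),
            (List.range l).map z = p ++ c :: q →
              z p.length = c ∧ ∀ j (hj : j < p.length), z j = p[j] := by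
          intro z l c q hz
          have hl : l = p.length + (q.length + 1) := by simpa using congrArg List.length hz
          refine ⟨?_, fun j hj => ?_⟩
          · have := congrArg (·[p.length]?) hz
            simpa [hl] using this
          · have := congrArg (·[j]?) hz
            simpa [hl, hj, List.getElem?_append, show j < p.length + (q.length + 1) by omega]
              using this
        obtain ⟨hx1, hx2⟩ := key _ _ _ _ hx
        obtain ⟨hy1, hy2⟩ := key _ _ _ _ hy
        refine ⟨p.length + 1, trunc_lt_iff.2 (Or.inr ⟨h, p.length, by omega, ?_, ?_⟩)⟩
        · intro j hj
          rw [hx2 j hj, hy2 j hj]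
        · rwa [hx1, hy1]

theorem endLT_map_of_mem_thompsonF {g : NeretinGroup d k} (hg : g ∈ ThompsonF d k)
    {x y : Ends d k} (h : EndLT x y) : EndLT (g.1 x) (g.1 y) := by
  obtain ⟨a, hao, hag⟩ := hg
  obtain ⟨N, hN⟩ := h.exists_leftOf
  have out : ∀ z : Ends d k, ∃ n, N ≤ n ∧ z.vertexAt n ∉ a.A.verts := by
    intro z
    obtain ⟨j, -, hj⟩ := a.A.exists_exit z
    exact ⟨max N (j + 1), le_max_left _ _, fun h => hj (a.A.mem_of_le z (le_max_right _ _) h)⟩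
  obtain ⟨m, hm, hxA⟩ := out x
  obtain ⟨n, hn, hyA⟩ := out y
  have h1 := (hao ⟨_, hxA⟩ ⟨_, hyA⟩).2 (hN m n hm hn)
  obtain ⟨m', hm'⟩ : g.1 x ∈ shadow (a.φ ⟨_, hxA⟩).1 := by
    rw [← hag]; exact ⟨x, ⟨m, rfl⟩, rfl⟩
  obtain ⟨n', hn'⟩ : g.1 y ∈ shadow (a.φ ⟨_, hyA⟩).1 := by
    rw [← hag]; exact ⟨y, ⟨n, rfl⟩, rfl⟩
  rw [← hm', ← hn'] at h1
  exact endLT_of_leftOf h1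

/-! ## Discreteness -/

theorem TreeAut.level_apply (ψ : TreeAut d k) (v : Vertex d k) : level (ψ v) = level v := by
  induction h : level v generalizing v with
  | zero =>
    rcases v with _ | ⟨i, w⟩
    · by_contra hne
      have : ψ none ≠ none := by rintro h0; rw [h0] at hne; exact hne rfl
      obtain ⟨u, hu⟩ := exists_parent this
      have h2 : IsChild (ψ.symm u) none := ψ.map_rel_iff.1 (by simpa using hu)
      generalize ψ.symm u = u' at h2
      cases h2
    · simp [level] at h
  | succ n ih =>
    obtain ⟨u, hu⟩ := exists_parent (v := v) (by rintro rfl; simp [level] at h)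
    have h1 := hu.level_eq
    rw [(ψ.map_rel_iff.2 hu).level_eq, ih u (by omega)]

theorem TreeAut.Induces.vertexAt_apply {ψ : TreeAut d k} {g : Ends d k ≃ₜ Ends d k}
    (h : ψ.Induces g) (x : Ends d k) (n : ℕ) : (g x).vertexAt n = ψ (x.vertexAt n) := by
  obtain ⟨m, hm⟩ := (h.mem_iff (x.vertexAt n) x).2 ⟨n, rfl⟩
  have := congrArg level hm
  rw [level_vertexAt, ψ.level_apply, level_vertexAt] at this
  rw [← hm, this]

theorem vertexAt_eq_iff_of_mem_levelStab {g : NeretinGroup d k} {m : ℕ} (hg : g ∈ levelStab d k m)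
    (x y : Ends d k) (n : ℕ) :
    (g.1 x).vertexAt n = (g.1 y).vertexAt n ↔ x.vertexAt n = y.vertexAt n := by
  obtain ⟨ψ, -, h⟩ := hg
  rw [h.vertexAt_apply, h.vertexAt_apply, ψ.injective.eq_iff]

theorem vertexAt_apply_of_mem_levelStab {g : NeretinGroup d k} {m : ℕ} (hg : g ∈ levelStab d k m)
    (x : Ends d k) : (g.1 x).vertexAt m = x.vertexAt m := by
  obtain ⟨ψ, hψ, h⟩ := hg
  rw [h.vertexAt_apply, hψ _ (level_vertexAt _ _).le]

/-- The end which follows a given word and then turns left forever. -/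
def LexWord.extend [NeZero d] {M : ℕ} (v : LexWord d k M) : Ends d k :=
  ((ofLex v).1, fun i => if h : i < M then ofLex (ofLex v).2 ⟨i, h⟩ else 0)

@[simp] theorem LexWord.trunc_extend [NeZero d] {M : ℕ} (v : LexWord d k M) :
    v.extend.trunc M = v := by
  simp only [Ends.trunc, LexWord.extend, Fin.is_lt, dif_pos]
  rfl

/-- A strictly monotone self-map of a finite linear order is the identity; this is applied to each
level. -/
theorem thompsonF_inf_levelStab (hd : 2 ≤ d) {g : NeretinGroup d k} (hF : g ∈ ThompsonF d k)
    (hg : g ∈ levelStab d k 0) : g = 1 := by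
  have : NeZero d := ⟨by omega⟩
  refine Subtype.ext (Homeomorph.ext fun x => ?_)
  change g.1 x = x
  by_contra hne
  obtain ⟨n, hn⟩ := exists_vertexAt_ne hne
  cases n with
  | zero => exact hn rfl
  | succ M =>
    -- The end chosen through `v` is immaterial: a tree automorphism determines the image at level
    -- `M + 1` from the vertex alone.
    let f : LexWord d k M → LexWord d k M := fun v => (g.1 v.extend).trunc M
    have hf : StrictMono f := by
      intro v w hvw
      have h1 : EndLT v.extend w.extend := ⟨M, by simpa using hvw⟩
      refine ((endLT_map_of_mem_thompsonF hF h1).trunc_le M).lt_of_ne fun h2 => ?_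
      rw [← vertexAt_succ_eq_iff_trunc, vertexAt_eq_iff_of_mem_levelStab hg,
        vertexAt_succ_eq_iff_trunc] at h2
      simp [hvw.ne] at h2
    have h1 : f (x.trunc M) = x.trunc M := le_antisymm hf.apply_le hf.le_apply
    have h2 : (g.1 (x.trunc M).extend).trunc M = (g.1 x).trunc M := by
      rw [← vertexAt_succ_eq_iff_trunc, vertexAt_eq_iff_of_mem_levelStab hg,
        vertexAt_succ_eq_iff_trunc, LexWord.trunc_extend]
    exact hn (vertexAt_succ_eq_iff_trunc.2 (h2.symm.trans h1))

theorem nhds_one_hasBasis (d k : ℕ) : (𝓝 (1 : NeretinGroup d k)).HasBasis (fun _ : ℕ => True)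
    fun n => (levelStab d k n : Set (NeretinGroup d k)) := by
  refine ⟨fun s => ?_⟩
  rw [(groupFilterBasis d k).nhds_one_hasBasis.mem_iff]
  constructor
  · rintro ⟨_, ⟨n, rfl⟩, h⟩
    exact ⟨n, trivial, h⟩
  · rintro ⟨n, -, h⟩
    exact ⟨_, ⟨n, rfl⟩, h⟩

/-- An element of every `levelStab` fixes all vertices on every ray, hence every end. -/
instance : T2Space (NeretinGroup d k) := by
  have : T1Space (NeretinGroup d k) := by
    refine IsTopologicalGroup.t1Space _ ?_
    refine isClosed_of_closure_subset fun g hg => ?_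
    have h1 : ∀ n, g ∈ levelStab d k n := by
      intro n
      rw [mem_closure_iff_nhds] at hg
      have hn : g • (levelStab d k n : Set (NeretinGroup d k)) ∈ 𝓝 g := by
        have := smul_mem_nhds_smul g ((nhds_one_hasBasis d k).mem_of_mem (i := n) trivial)
        simpa using this
      obtain ⟨_, ⟨h, hh, rfl⟩, h1⟩ := hg _ hn
      have h1 : g * h = 1 := h1
      rw [eq_inv_of_mul_eq_one_left h1]
      exact inv_mem hh
    refine Subtype.ext (Homeomorph.ext fun x => ?_)
    by_contra hne
    obtain ⟨n, hn⟩ := exists_vertexAt_ne hne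
    exact hn (vertexAt_apply_of_mem_levelStab (h1 n) x)
  infer_instance

theorem discreteTopology_thompsonF (hd : 2 ≤ d) : DiscreteTopology (ThompsonF d k) := by
  refine discreteTopology_of_isOpen_singleton_one ?_
  refine isOpen_iff_mem_nhds.2 ?_
  rintro _ rfl
  rw [mem_nhds_subtype]
  refine ⟨_, (nhds_one_hasBasis d k).mem_of_mem (i := 0) trivial, fun g hg => ?_⟩
  exact Subtype.ext (thompsonF_inf_levelStab hd g.2 hg)

theorem thompsonF_mem_piecewiseFixingMeasure
    (hF : IsClosed (ThompsonF d k : Set (NeretinGroup d k))) :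
    (⟨ThompsonF d k, hF⟩ : ClosedSubgroup (NeretinGroup d k)) ∈
      piecewiseFixingMeasure (NeretinGroup d k) (Ends d k) := by
  intro α hα hne
  obtain ⟨x, hx, hmin⟩ := exists_leftmost hα.isClosed.isCompact hne
  refine ⟨Measure.dirac x, inferInstance, inferInstance, ?_, ?_⟩
  · rw [Measure.dirac_apply' _ hα.isOpen.measurableSet.compl]
    simp [hx]
  · intro h (hh : h ∈ ThompsonF d k) hα'
    rw [Measure.map_dirac' (continuous_const_smul h).measurable]
    congr 1
    by_contra hne'
    have hhx : h • x ∈ α := hα' ▸ Set.smul_mem_smul_set hx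
    have hhx' : h⁻¹ • x ∈ α := by rwa [← Set.mem_smul_set_iff_inv_smul_mem, hα']
    -- If the leftmost end `x` were moved, either `h` or its inverse would carry it further left
    -- within `α`.
    rcases EndLT.trichotomy hne' with h1 | h1
    · exact hmin _ hhx h1
    · refine hmin _ hhx' ?_
      have := endLT_map_of_mem_thompsonF (inv_mem hh) h1
      change EndLT (h⁻¹ • x) (h⁻¹ • h • x) at this
      rwa [inv_smul_smul] at this

/-! ## Local isomorphisms -/

/-- `c` maps the subtree at the vertex of level `n` on the ray `ξ` isomorphically onto the
subtree at the vertex of level `n'` on the ray `c ξ`. -/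
def LocalIso (c : Ends d k → Ends d k) (ξ : Ends d k) (n n' : ℕ) : Prop :=
  ∀ x y, x.vertexAt n = ξ.vertexAt n → ∀ j,
    ((c x).vertexAt (n' + j) = (c y).vertexAt (n' + j) ↔
      x.vertexAt (n + j) = y.vertexAt (n + j))

/-- `c` maps some subtree, with root of level at most `L`, isomorphically onto a disjoint subtree
with root of level at most `L`. -/
def MovesSubtree (L : ℕ) (c : Ends d k → Ends d k) : Prop :=
  ∃ ξ n n', n ≤ L ∧ n' ≤ L ∧ (c ξ).vertexAt (min n n') ≠ ξ.vertexAt (min n n') ∧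
    LocalIso c ξ n n'

theorem MovesSubtree.mono {L L' : ℕ} (hL : L ≤ L') {c : Ends d k → Ends d k}
    (h : MovesSubtree L c) : MovesSubtree L' c := by
  obtain ⟨ξ, n, n', hn, hn', h⟩ := h
  exact ⟨ξ, n, n', hn.trans hL, hn'.trans hL, h⟩

theorem AlmostAut.Induces.vertexAt_apply {a : AlmostAut d k} {c : Ends d k ≃ₜ Ends d k}
    (h : a.Induces c) (x : Ends d k) {n : ℕ} (hn : x.vertexAt n ∉ a.A.verts) (j : ℕ)
    (hj : x.vertexAt (n + j) ∉ a.A.verts) :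
    (a.φ ⟨_, hj⟩).1 = (c x).vertexAt (level (a.φ ⟨_, hn⟩).1 + j) := by
  have hlev : level (a.φ ⟨_, hj⟩).1 = level (a.φ ⟨_, hn⟩).1 + j := by
    induction j with
    | zero => rfl
    | succ j ih =>
      have hj' : x.vertexAt (n + j) ∉ a.A.verts := fun h' =>
        hn (a.A.mem_of_le x (Nat.le_add_right _ _) h')
      have h1 := (a.isChild_iff ⟨_, hj'⟩ ⟨_, hj⟩).2 (isChild_vertexAt x (n + j))
      rw [h1.level_eq, ih hj']
      rfl
  obtain ⟨m, hm⟩ : c x ∈ shadow (a.φ ⟨_, hj⟩).1 := by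
    rw [← h]
    exact ⟨x, ⟨_, rfl⟩, rfl⟩
  rw [← hlev, ← hm, level_vertexAt]

/-- If `c ξ` and `ξ` part at level `p`, descending `p` levels below a vertex outside the source
subtree puts both roots at level at least `p`. Differing at level `min n n'` means that neither root
is an ancestor of the other. -/
theorem exists_movesSubtree {c : NeretinGroup d k} (hc : c ≠ 1) :
    ∃ ξ n n', (c.1 ξ).vertexAt (min n n') ≠ ξ.vertexAt (min n n') ∧ LocalIso c.1 ξ n n' := by
  obtain ⟨ξ, hξ⟩ : ∃ ξ, c.1 ξ ≠ ξ := by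
    by_contra! h
    exact hc (Subtype.ext (Homeomorph.ext h))
  obtain ⟨p, hp⟩ := exists_vertexAt_ne hξ
  obtain ⟨a, ha⟩ := c.2
  obtain ⟨N, -, hN⟩ := a.A.exists_exit ξ
  have hout : ∀ x : Ends d k, x.vertexAt (N + 1) = ξ.vertexAt (N + 1) → ∀ j,
      x.vertexAt (N + 1 + j) ∉ a.A.verts := by
    intro x hx j h
    have := a.A.mem_of_le x (Nat.le_add_right (N + 1) j) h
    rw [hx] at this
    exact hN this
  refine ⟨ξ, N + 1 + p, level (a.φ ⟨_, hN⟩).1 + p, fun h => ?_, fun x y hx j => ?_⟩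
  · exact hp (vertexAt_eq_of_le h p (by omega))
  · have hx' := vertexAt_eq_of_le hx (N + 1) (by omega)
    have h1 := ha.vertexAt_apply x (hout x hx' 0) (p + j) (hout x hx' _)
    have e : (⟨x.vertexAt (N + 1), hout x hx' 0⟩ : {v : Vertex d k // v ∉ a.A.verts}) =
      ⟨_, hN⟩ := Subtype.ext hx'
    rw [e] at h1
    have h2 := congrArg (c.1 y ∈ ·) (ha ⟨_, hout x hx' (p + j)⟩)
    rw [h1] at h2
    simp only [c.1.injective.mem_set_image, mem_shadow_vertexAt, eq_iff_iff] at h2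
    rw [eq_comm, add_assoc, add_assoc, ← h2, eq_comm]

/-- The same witness serves a whole neighbourhood of `c`, so that compactness yields a uniform bound
on the levels. -/
theorem LocalIso.mul_levelStab {c o : NeretinGroup d k} {ξ : Ends d k} {n n' : ℕ}
    (hc : (c.1 ξ).vertexAt (min n n') ≠ ξ.vertexAt (min n n')) (h : LocalIso c.1 ξ n n')
    (ho : o ∈ levelStab d k n) :
    ((c * o).1 ξ).vertexAt (min n n') ≠ ξ.vertexAt (min n n') ∧ LocalIso (c * o).1 ξ n n' := by
  have hfix := vertexAt_apply_of_mem_levelStab ho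
  constructor
  · have h1 := (h (o.1 ξ) ξ (hfix ξ) 0).2 (hfix ξ)
    have h2 := vertexAt_eq_of_le h1 (min n n') (min_le_right _ _)
    change (c.1 (o.1 ξ)).vertexAt _ ≠ _
    rwa [h2]
  · intro x y hx j
    rw [← vertexAt_eq_iff_of_mem_levelStab ho x y]
    exact h (o.1 x) (o.1 y) ((hfix x).trans hx) j

theorem exists_forall_movesSubtree {C : Set (NeretinGroup d k)} (hC : IsCompact C)
    (h1 : (1 : NeretinGroup d k) ∉ C) : ∃ L, ∀ c ∈ C, MovesSubtree L c.1 := by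
  have h1 : ∀ c ∈ C, c ≠ 1 := fun c hc h => h1 (h ▸ hc)
  refine hC.induction_on (p := fun s => ∃ L, ∀ c ∈ s, MovesSubtree L c.1) ?_ ?_ ?_ ?_
  · exact ⟨0, by simp⟩
  · rintro s t hst ⟨L, h⟩
    exact ⟨L, fun c hc => h c (hst hc)⟩
  · rintro s t ⟨L, h⟩ ⟨L', h'⟩
    refine ⟨max L L', ?_⟩
    rintro c (hc | hc)
    · exact (h c hc).mono (le_max_left _ _)
    · exact (h' c hc).mono (le_max_right _ _)
  · intro c hc
    obtain ⟨ξ, n, n', hne, hiso⟩ := exists_movesSubtree (h1 c hc)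
    refine ⟨c • (levelStab d k n : Set (NeretinGroup d k)), mem_nhdsWithin_of_mem_nhds ?_,
      max n n', ?_⟩
    · have := smul_mem_nhds_smul c ((nhds_one_hasBasis d k).mem_of_mem (i := n) trivial)
      simpa using this
    · rintro _ ⟨o, ho, rfl⟩
      exact ⟨ξ, n, n', le_max_left _ _, le_max_right _ _, LocalIso.mul_levelStab hne hiso ho⟩

/-! ## Permuting the vertices of a given level -/

theorem exists_vertexAt_eq {v : Vertex d k} (hd : 0 < d) (hv : v ≠ none) :
    ∃ ξ : Ends d k, ξ.vertexAt (level v) = v := by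
  rcases v with _ | ⟨i, w⟩
  · exact absurd rfl hv
  · refine ⟨(i, fun j => w.getD j ⟨0, hd⟩), ?_⟩
    simp only [level, Ends.vertexAt]
    congr 2
    refine List.ext_getElem (by simp) fun j h1 h2 => ?_
    simp [h2]

theorem isChild_vertexAt_iff {v : Vertex d k} {η : Ends d k} {n : ℕ} :
    IsChild v (η.vertexAt n) ↔ level v + 1 = n ∧ η.vertexAt (level v) = v := by
  constructor
  · intro h
    have h1 := h.level_eq
    rw [level_vertexAt] at h1
    subst h1
    exact ⟨rfl, (isChild_vertexAt η (level v)).parent_unique h⟩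
  · rintro ⟨rfl, h⟩
    have := isChild_vertexAt η (level v)
    rwa [h] at this

/-- The ball around the root. -/
noncomputable def ballSubtree (d k M : ℕ) : FiniteSubtree d k where
  verts := (finite_level_le d k M).toFinset
  root_mem := by simp [level]
  parent_mem u v h hv := by
    simp only [Set.Finite.mem_toFinset, Set.mem_ofPred_eq] at hv ⊢
    rw [h.level_eq] at hv
    omega

theorem mem_ballSubtree {M : ℕ} {v : Vertex d k} :
    v ∈ (ballSubtree d k M).verts ↔ level v ≤ M := by
  simp [ballSubtree]

/-- A homeomorphism which respects the vertices outside a ball belongs to the Neretin group. -/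
theorem mem_neretinGroup_of_forall (hd : 0 < d) {g : Ends d k ≃ₜ Ends d k} {M : ℕ}
    (h : ∀ n, M < n → ∀ x y, (g x).vertexAt n = (g y).vertexAt n ↔ x.vertexAt n = y.vertexAt n) :
    g ∈ NeretinGroup d k := by
  let A := ballSubtree d k M
  have hA : ∀ v : {v : Vertex d k // v ∉ A.verts}, M < level v.1 := fun v =>
    not_le.1 fun h => v.2 (mem_ballSubtree.2 h)
  have hA' : ∀ (x : Ends d k) n, M < n → x.vertexAt n ∉ A.verts := fun x n hn h => by
    rw [mem_ballSubtree, level_vertexAt] at h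
    omega
  choose rep hrep using fun v : {v : Vertex d k // v ∉ A.verts} =>
    exists_vertexAt_eq (v := v.1) hd (fun h0 => v.2 (h0 ▸ A.root_mem))
  -- By hypothesis the image vertex depends only on `v`, so any end `rep v` through it may be used.
  let φ : {v : Vertex d k // v ∉ A.verts} ≃ {v : Vertex d k // v ∉ A.verts} :=
    { toFun := fun v => ⟨(g (rep v)).vertexAt (level v.1), hA' _ _ (hA v)⟩
      invFun := fun v => ⟨(g.symm (rep v)).vertexAt (level v.1), hA' _ _ (hA v)⟩
      left_inv := fun v => by
        refine Subtype.ext ?_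
        set w : {v : Vertex d k // v ∉ A.verts} :=
          ⟨(g (rep v)).vertexAt (level v.1), hA' _ _ (hA v)⟩
        have h1 : level w.1 = level v.1 := level_vertexAt _ _
        have h2 := hrep w
        change (g.symm (rep w)).vertexAt (level w.1) = v.1
        conv_rhs => rw [← hrep v]
        rw [h1, ← h _ (hA v), g.apply_symm_apply]
        rwa [h1] at h2
      right_inv := fun v => by
        refine Subtype.ext ?_
        set w : {v : Vertex d k // v ∉ A.verts} :=
          ⟨(g.symm (rep v)).vertexAt (level v.1), hA' _ _ (hA v)⟩
        have h1 : level w.1 = level v.1 := level_vertexAt _ _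
        have h2 := hrep w
        change (g (rep w)).vertexAt (level w.1) = v.1
        rw [h1] at h2 ⊢
        change _ = (g.symm (rep v)).vertexAt _ at h2
        rw [← h _ (hA v), g.apply_symm_apply] at h2
        rw [h2, hrep v] }
  have hφ : ∀ v, (φ v).1 = (g (rep v)).vertexAt (level v.1) := fun v => rfl
  refine ⟨⟨A, A, φ, fun u v => ?_⟩, fun v => ?_⟩
  · rw [hφ v, isChild_vertexAt_iff, hφ u, level_vertexAt, h _ (hA u), hrep u]
    conv_rhs => rw [← hrep v, isChild_vertexAt_iff]
  · have h1 := hφ v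
    change g '' shadow v.1 = shadow (φ v).1
    rw [h1]
    conv_lhs => rw [← hrep v]
    ext y
    obtain ⟨x, rfl⟩ := g.surjective y
    rw [g.injective.mem_set_image, mem_shadow_vertexAt, mem_shadow_vertexAt, h _ (hA v)]

/-- Apply a permutation to the first letters of an end. -/
def permFun {M : ℕ} (τ : Equiv.Perm (LexWord d k M)) (x : Ends d k) : Ends d k :=
  ((ofLex (τ (x.trunc M))).1,
    fun i => if h : i < M then ofLex (ofLex (τ (x.trunc M))).2 ⟨i, h⟩ else x.2 i)

theorem trunc_permFun {M : ℕ} (τ : Equiv.Perm (LexWord d k M)) (x : Ends d k) :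
    (permFun τ x).trunc M = τ (x.trunc M) := by
  simp only [Ends.trunc, permFun, Fin.is_lt, dif_pos]
  rfl

theorem permFun_permFun {M : ℕ} {τ σ : Equiv.Perm (LexWord d k M)} (h : ∀ v, τ (σ v) = v)
    (x : Ends d k) : permFun τ (permFun σ x) = x := by
  have h1 : τ ((permFun σ x).trunc M) = x.trunc M := by rw [trunc_permFun, h]
  rw [permFun, h1]
  refine Prod.ext rfl (funext fun i => ?_)
  by_cases hi : i < M
  · simp [hi, Ends.trunc]
  · simp [hi, permFun]

theorem continuous_permFun {M : ℕ} (τ : Equiv.Perm (LexWord d k M)) :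
    Continuous (permFun τ : Ends d k → Ends d k) := by
  have hloc : IsLocallyConstant fun x : Ends d k => τ (x.trunc M) := by
    refine (IsLocallyConstant.iff_eventually_eq _).2 fun x => ?_
    filter_upwards [(isOpen_setOf_vertexAt_eq x (M + 1)).mem_nhds rfl] with y hy
    rw [vertexAt_succ_eq_iff_trunc.1 hy]
  refine (hloc.comp fun v => (ofLex v).1).continuous.prodMk (continuous_pi fun i => ?_)
  by_cases hi : i < M
  · simp only [hi, dif_pos]
    exact (hloc.comp fun v => ofLex (ofLex v).2 ⟨i, hi⟩).continuous
  · simp only [hi, dif_neg, not_false_eq_true]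
    fun_prop

/-- The homeomorphism permuting the vertices at distance `M + 1` from the root. -/
def permHomeo {M : ℕ} (τ : Equiv.Perm (LexWord d k M)) : Ends d k ≃ₜ Ends d k where
  toFun := permFun τ
  invFun := permFun τ.symm
  left_inv := permFun_permFun (by simp)
  right_inv := permFun_permFun (by simp)
  continuous_toFun := continuous_permFun τ
  continuous_invFun := continuous_permFun τ.symm

/-- The letters after the permuted ones are left unchanged, so agreement at any level beyond `M` is
preserved, in both directions. -/
theorem permHomeo_mem {M : ℕ} (hd : 0 < d) (τ : Equiv.Perm (LexWord d k M)) :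
    permHomeo τ ∈ NeretinGroup d k := by
  have key : ∀ (σ : Equiv.Perm (LexWord d k M)) n (x y : Ends d k),
      x.vertexAt (M + 1 + n) = y.vertexAt (M + 1 + n) →
        (permFun σ x).vertexAt (M + 1 + n) = (permFun σ y).vertexAt (M + 1 + n) := by
    intro σ n x y h
    have h0 := vertexAt_succ_eq_iff_trunc.1 (vertexAt_eq_of_le h (M + 1) (by omega))
    rw [show M + 1 + n = M + n + 1 by omega, vertexAt_succ_eq_iff] at h ⊢
    refine ⟨by simp only [permFun, h0], fun i hi => ?_⟩
    simp only [permFun, h0, h.2 i hi]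
  refine mem_neretinGroup_of_forall hd (M := M) fun n hn x y => ?_
  obtain ⟨n, rfl⟩ := Nat.exists_eq_add_of_le (show M + 1 ≤ n from hn)
  refine ⟨fun h => ?_, key τ n x y⟩
  have := key τ.symm n _ _ h
  change (permFun τ.symm (permFun τ x)).vertexAt _ =
    (permFun τ.symm (permFun τ y)).vertexAt _ at this
  rwa [permFun_permFun (by simp), permFun_permFun (by simp)] at this

/-- A finite linear order can be permuted so that a given function becomes monotone. -/
theorem exists_perm_sorting {V : Type*} [LinearOrder V] [Finite V] (ρ : V → ℕ) :
    ∃ τ : Equiv.Perm V, ∀ v w, ρ v < ρ w → τ v < τ w := by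
  have := Fintype.ofFinite V
  let e : Fin (Fintype.card V) ≃o V := Fintype.orderIsoFinOfCardEq V rfl
  let s := Tuple.sort (ρ ∘ e)
  -- The inverse of the sorting permutation sends an element to its position in the list sorted by
  -- `ρ`.
  refine ⟨e.toEquiv.symm.trans (s.symm.trans e.toEquiv), fun v w h => ?_⟩
  by_contra! h'
  have h1 : s.symm (e.symm w) ≤ s.symm (e.symm v) := e.le_iff_le.1 h'
  have h2 := Tuple.monotone_sort (ρ ∘ e) h1
  change ρ (e (s (s.symm _))) ≤ ρ (e (s (s.symm _))) at h2
  simp at h2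
  omega

/-- Any ranking of the vertices of one level is thereby respected by the pullback of `EndLT` along
some group element. -/
theorem exists_sorting_mem_neretinGroup (hd : 0 < d) {M : ℕ} {r : Ends d k → ℕ}
    (hr : ∀ x y, x.vertexAt (M + 1) = y.vertexAt (M + 1) → r x = r y) :
    ∃ g : NeretinGroup d k, ∀ x y, r x < r y → EndLT (g.1 x) (g.1 y) := by
  have : NeZero d := ⟨by omega⟩
  obtain ⟨τ, hτ⟩ := exists_perm_sorting fun v : LexWord d k M => r v.extend
  refine ⟨⟨_, permHomeo_mem hd τ⟩, fun x y h => ⟨M, ?_⟩⟩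
  change (permFun τ x).trunc M < (permFun τ y).trunc M
  rw [trunc_permFun, trunc_permFun]
  refine hτ _ _ ?_
  have e : ∀ x : Ends d k, r (x.trunc M).extend = r x := fun x =>
    hr _ _ (vertexAt_succ_eq_iff_trunc.2 (LexWord.trunc_extend _))
  rwa [e, e]

/-! ## An order in which disjoint subtrees are not isomorphic -/

/-- In the subtree at the vertex of level `n` on the ray `x`, some subtree of relative depth
`j` is an initial segment for the relation `prec`. -/
def HasInitialSubtree (prec : Ends d k → Ends d k → Prop) (x : Ends d k) (n j : ℕ) : Prop :=
  ∃ x' : Ends d k, x'.vertexAt n = x.vertexAt n ∧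
    ∀ y z : Ends d k, y.vertexAt (n + j) = x'.vertexAt (n + j) → z.vertexAt n = x.vertexAt n →
      z.vertexAt (n + j) ≠ x'.vertexAt (n + j) → prec y z

/-- The possible depths `j` are thus an invariant of subtrees under local isomorphisms preserving
`prec`. -/
theorem HasInitialSubtree.map {prec : Ends d k → Ends d k → Prop} {c : Ends d k ≃ Ends d k}
    (hc : ∀ y z, prec y z → prec (c y) (c z)) {ξ : Ends d k} {n n' j : ℕ}
    (hiso : LocalIso c ξ n n') (h : HasInitialSubtree prec ξ n j) :
    HasInitialSubtree prec (c ξ) n' j := by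
  obtain ⟨x', hx', h⟩ := h
  refine ⟨c x', (hiso _ _ hx' 0).2 hx', fun y z hy hz hne => ?_⟩
  obtain ⟨y, rfl⟩ := c.surjective y
  obtain ⟨z, rfl⟩ := c.surjective z
  refine hc _ _ (h y z ((hiso _ _ hx' j).1 hy.symm).symm ((hiso _ _ rfl 0).1 hz.symm).symm
    fun h' => hne ((hiso _ _ hx' j).2 h'.symm).symm)

theorem LocalIso.symm {c : Ends d k ≃ Ends d k} {ξ : Ends d k} {n n' : ℕ}
    (h : LocalIso c ξ n n') : LocalIso c.symm (c ξ) n' n := by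
  intro x y hx j
  obtain ⟨x, rfl⟩ := c.surjective x
  obtain ⟨y, rfl⟩ := c.surjective y
  rw [c.symm_apply_apply, c.symm_apply_apply]
  exact (h x y ((h ξ x rfl 0).1 hx.symm).symm j).symm

/-! ### The ranking with marked subtrees, and its least initial depths -/

section Rank

variable {L : ℕ} (f : LexWord d k L → ℕ)

/-- The number of letters `0` that mark the special subtree below the vertex `v`. -/
def markLength (v : LexWord d k L) : ℕ := (L + 2) * (f v + 1)

theorem le_markLength (v : LexWord d k L) : L + 2 ≤ markLength f v :=
  Nat.le_mul_of_pos_right _ (by omega)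

variable [NeZero d]

/-- The end `x` has at least `l` letters `0` after the first `L` letters. -/
def ZerosAfter (L l : ℕ) (x : Ends d k) : Prop := ∀ j, L ≤ j → j < L + l → x.2 j = 0

open Classical in
/-- The first letters of `x` determine its rank: the special subtrees come first, in the order
given by `f`, the rest of the subtrees at their parents come last. -/
noncomputable def rank (B : ℕ) (x : Ends d k) : ℕ :=
  if ZerosAfter L (markLength f (x.trunc L)) x then f (x.trunc L) else
    if ZerosAfter L (markLength f (x.trunc L) - 1) x then B + 1 else B

variable {f} {B : ℕ}

theorem rank_eq_of_vertexAt_eq (hB : ∀ v, f v < B) {x y : Ends d k}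
    (h : x.vertexAt (L + (L + 2) * (B + 1) + 1) = y.vertexAt (L + (L + 2) * (B + 1) + 1)) :
    rank f B x = rank f B y := by
  have h0 : x.trunc L = y.trunc L := vertexAt_succ_eq_iff_trunc.1 (vertexAt_eq_of_le h _ (by omega))
  have hlen : ∀ v, markLength f v ≤ (L + 2) * (B + 1) := fun v =>
    Nat.mul_le_mul_left _ (by have := hB v; omega)
  have hZ : ∀ l, l ≤ (L + 2) * (B + 1) → (ZerosAfter L l x ↔ ZerosAfter L l y) := by
    intro l hl
    refine forall_congr' fun j => forall_congr' fun _ => forall_congr' fun hj => ?_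
    rw [(vertexAt_succ_eq_iff.1 h).2 j (by omega)]
  have h1 := hlen (y.trunc L)
  rw [rank, rank, h0]
  classical exact if_congr (hZ _ h1) rfl (if_congr (hZ _ (by omega)) rfl rfl)

/-- Among the marked subtrees below the given vertex, the one with least `f` comes before everything
else there, which gives depth `t`. A shallower initial subtree would have to contain it, and with it
the rest of the subtree at its parent, which has the top rank `B + 1`; but elements of rank at most
`B` remain outside. -/
theorem exists_initial_depth (hd : 2 ≤ d) (hf : f.Injective) (hB : ∀ v, f v < B)
    {prec : Ends d k → Ends d k → Prop} (hasymm : ∀ x y, prec x y → ¬ prec y x)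
    (hprec : ∀ x y, rank f B x < rank f B y → prec x y) (x : Ends d k) {n : ℕ} (hn : 1 ≤ n)
    (hnL : n ≤ L + 1) : ∃ (t : ℕ) (p : Ends d k), p.vertexAt n = x.vertexAt n ∧
      t + n = L + markLength f (p.trunc L) + 1 ∧ HasInitialSubtree prec x n t ∧
      ∀ j, 1 ≤ j → j < t → ¬ HasInitialSubtree prec x n j := by
  obtain ⟨q, hq, hqmin⟩ : ∃ q : Ends d k, q.vertexAt n = x.vertexAt n ∧
      ∀ y : Ends d k, y.vertexAt n = x.vertexAt n → f (q.trunc L) ≤ f (y.trunc L) := by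
    obtain ⟨q, hq, h⟩ := (measure fun y : Ends d k => f (y.trunc L)).wf.has_min
      {y | y.vertexAt n = x.vertexAt n} ⟨x, rfl⟩
    exact ⟨q, hq, fun y hy => not_lt.1 (h y hy)⟩
  set p : Ends d k := (q.trunc L).extend with hp
  have hpq : p.trunc L = q.trunc L := LexWord.trunc_extend _
  have hp0 : ∀ j, L ≤ j → p.2 j = 0 := fun j hj => by simp [hp, LexWord.extend, not_lt.2 hj]
  have hpx : p.vertexAt n = x.vertexAt n := by
    rw [← hq]
    exact vertexAt_eq_of_le (vertexAt_succ_eq_iff_trunc.2 hpq) n hnL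
  rw [← hpq] at hqmin
  set s := markLength f (p.trunc L)
  have hs2 : L + 2 ≤ s := le_markLength f _
  have hrankp : rank f B p = f (p.trunc L) := if_pos fun j hj _ => hp0 j hj
  -- elements outside the special subtree have larger rank
  have hlarge : ∀ z : Ends d k, z.vertexAt n = x.vertexAt n →
      z.vertexAt (L + s + 1) ≠ p.vertexAt (L + s + 1) → f (p.trunc L) < rank f B z := by
    intro z hz hne
    rw [rank]
    split_ifs with h1 h2
    · refine (hqmin z hz).lt_of_ne fun he => hne ?_
      have he := hf he
      have he' := trunc_eq_iff.1 he
      refine vertexAt_succ_eq_iff.2 ⟨he'.1.symm, fun i hi => ?_⟩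
      rcases lt_or_ge i L with hiL | hiL
      · exact (he'.2 i hiL).symm
      · rw [hp0 i hiL]
        exact h1 i hiL (by rwa [← he])
    · have := hB (p.trunc L); omega
    · exact hB _
  refine ⟨L + s + 1 - n, p, hpx, by omega, ⟨p, hpx, fun y z hy hz hne => ?_⟩, fun j hj hjt => ?_⟩
  · rw [show n + (L + s + 1 - n) = L + s + 1 by omega] at hy hne
    refine hprec y z ?_
    have hyp := vertexAt_succ_eq_iff.1 hy
    have hyL : y.trunc L = p.trunc L :=
      trunc_eq_iff.2 ⟨hyp.1, fun i hi => hyp.2 i (by omega)⟩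
    have : rank f B y = f (p.trunc L) := by
      rw [rank, hyL, if_pos]
      intro j hj hj'
      rw [hyp.2 j hj', hp0 j hj]
    rw [this]
    exact hlarge z hz hne
  · rintro ⟨x', hx', h⟩
    -- An initial subtree must contain `p`, since `p` has a smaller rank than everything outside the
    -- marked subtree.
    have hpx' : p.vertexAt (n + j) = x'.vertexAt (n + j) := by
      by_contra hne
      refine hasymm _ _ (h x' p rfl hpx hne) (hprec _ _ ?_)
      rw [hrankp]
      exact hlarge x' hx' fun h' => hne (vertexAt_eq_of_le h' (n + j) (by omega)).symm
    rw [← hpx'] at h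
    obtain ⟨m, hm⟩ : ∃ m, n + j = m + 1 + 1 := ⟨n + j - 2, by omega⟩
    rw [hm] at h
    let one : Fin d := ⟨1, by omega⟩
    have hone : one ≠ 0 := fun h0 => by simpa [one] using congrArg Fin.val h0
    -- `y` leaves the marked subtree at its last letter, so it has rank `B + 1` and still lies in
    -- the supposed initial subtree. `z` branches off just before the root of that subtree and has
    -- rank at most `B`.
    let y : Ends d k := (p.1, Function.update p.2 (L + s - 1) one)
    let z : Ends d k :=
      (p.1, fun i => if i < m then p.2 i else if p.2 i = 0 then one else 0)
    have hyp : ∀ i < L + s - 1, y.2 i = p.2 i := fun i hi => Function.update_of_ne (by omega) _ _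
    have hzp : ∀ i < m, z.2 i = p.2 i := fun i hi => if_pos hi
    have hz0 : ∀ i, m ≤ i → L ≤ i → z.2 i = one := fun i hi hi' => by
      simp [z, not_lt.2 hi, hp0 i hi']
    have hyL : y.trunc L = p.trunc L := trunc_eq_iff.2 ⟨rfl, fun i hi => hyp i (by omega)⟩
    have hry : rank f B y = B + 1 := by
      rw [rank, hyL, if_neg, if_pos]
      · intro i hi hi'
        rw [hyp i (by omega), hp0 i hi]
      · intro h0
        have := h0 (L + s - 1) (by omega) (by omega)
        exact hone (by simpa [y] using this)
    have hrz : rank f B z ≤ B := by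
      have hnot : ¬ ZerosAfter L (markLength f (z.trunc L) - 1) z := by
        intro h0
        have hlen := le_markLength f (z.trunc L)
        have := h0 (max m L) (le_max_right _ _) ?_
        · rw [hz0 _ (le_max_left _ _) (le_max_right _ _)] at this
          exact hone this
        · rcases lt_or_ge m L with hmL | hmL
          -- Here the letter at position `L` already breaks the mark, whose length is at least `L +
          -- 2`.
          · omega
          · have : z.trunc L = p.trunc L :=
              trunc_eq_iff.2 ⟨rfl, fun i hi => hzp i (by omega)⟩
            rw [this]
            omega
      rw [rank, if_neg hnot]
      split_ifs
      · exact (hB _).le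
      · exact le_rfl
    refine hasymm y z (h y z ?_ ?_ ?_) (hprec z y (by omega))
    · exact vertexAt_succ_eq_iff.2 ⟨rfl, fun i hi => hyp i (by omega)⟩
    · have hz : z.vertexAt (m + 1) = p.vertexAt (m + 1) := vertexAt_succ_eq_iff.2 ⟨rfl, hzp⟩
      rw [← hpx]
      exact vertexAt_eq_of_le hz n (by omega)
    · intro hne
      have := (vertexAt_succ_eq_iff.1 hne).2 m (by omega)
      simp only [z, lt_irrefl, if_false] at this
      split_ifs at this with h0
      · exact hone (this.trans h0)
      · exact h0 this.symm

end Rank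

/-- For every `L` there is a conjugate of Thompson's group no element of which maps a subtree
with root of level at most `L` to a disjoint one of this kind. -/
theorem exists_conj_not_movesSubtree (hd : 2 ≤ d) (L : ℕ) : ∃ g : NeretinGroup d k,
    ∀ h ∈ ThompsonF d k, ¬ MovesSubtree L (g⁻¹ * h * g : NeretinGroup d k).1 := by
  have : NeZero d := ⟨by omega⟩
  obtain ⟨f, hf⟩ := exists_injective_nat (LexWord d k L)
  obtain ⟨B, hB⟩ : ∃ B, ∀ v, f v < B := by
    obtain ⟨B, hB⟩ := (Set.finite_range f).bddAbove
    exact ⟨B + 1, fun v => Nat.lt_succ_of_le (hB ⟨v, rfl⟩)⟩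
  obtain ⟨g, hg⟩ := exists_sorting_mem_neretinGroup (by omega) (r := rank f B)
    fun x y => rank_eq_of_vertexAt_eq hB
  refine ⟨g, ?_⟩
  rintro h hh ⟨ξ, n, n', hn, hn', hne, hiso⟩
  set c : NeretinGroup d k := g⁻¹ * h * g with hc
  have h1 : 1 ≤ min n n' := by
    by_contra h0
    obtain h0 : min n n' = 0 := by omega
    rw [h0] at hne
    exact hne rfl
  let prec : Ends d k → Ends d k → Prop := fun x y => EndLT (g.1 x) (g.1 y)
  have hmap : ∀ h' ∈ ThompsonF d k, ∀ y z, prec y z →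
      prec ((g⁻¹ * h' * g).1 y) ((g⁻¹ * h' * g).1 z) := by
    intro h' hh' y z hyz
    have e : ∀ y, g.1 ((g⁻¹ * h' * g).1 y) = h'.1 (g.1 y) := by
      intro y
      change (g * (g⁻¹ * h' * g)) • y = (h' * g) • y
      congr 1
      group
    change EndLT _ _
    rw [e, e]
    exact endLT_map_of_mem_thompsonF hh' hyz
  have hmap' : ∀ y z, prec y z → prec (c.1.symm y) (c.1.symm z) := by
    have e : c⁻¹ = g⁻¹ * h⁻¹ * g := by rw [hc]; group
    intro y z hyz
    change prec (c⁻¹.1 y) (c⁻¹.1 z)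
    rw [e]
    exact hmap _ (inv_mem hh) y z hyz
  have hdepth := fun x n => exists_initial_depth (n := n) hd hf hB (prec := prec)
    (fun x y => EndLT.asymm) hg x
  obtain ⟨t, p, hp, ht, hI, hmin⟩ := hdepth ξ n (by omega) (by omega)
  obtain ⟨t', p', hp', ht', hI', hmin'⟩ := hdepth (c.1 ξ) n' (by omega) (by omega)
  have hle := le_markLength f (p.trunc L)
  have hle' := le_markLength f (p'.trunc L)
  have hJ : HasInitialSubtree prec (c.1 ξ) n' t :=
    HasInitialSubtree.map (c := c.1.toEquiv) (hmap h hh) hiso hI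
  have hJ' : HasInitialSubtree prec ξ n t' := by
    have := HasInitialSubtree.map (c := c.1.toEquiv.symm) hmap'
      (LocalIso.symm (c := c.1.toEquiv) hiso) hI'
    simpa using this
  -- `c` and its inverse transport initial subtrees, so the least depths agree.
  have htt : t = t' := by
    refine le_antisymm (not_lt.1 fun hlt => ?_) (not_lt.1 fun hlt => ?_)
    · exact hmin t' (by omega) hlt hJ'
    · exact hmin' t (by omega) hlt hJ
  -- Equal values of the injective `f` would make the two roots agree at level `min n n'`, against
  -- disjointness.
  have hpp : f (p.trunc L) ≠ f (p'.trunc L) := by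
    intro he
    have h2 := vertexAt_eq_of_le (vertexAt_succ_eq_iff_trunc.2 (hf he)) (min n n') (by omega)
    rw [vertexAt_eq_of_le hp _ (min_le_left _ _), vertexAt_eq_of_le hp' _ (min_le_right _ _)] at h2
    exact hne h2.symm
  -- Equal depths force the mark lengths to differ by at most `|n - n'| < L + 2`, whereas distinct
  -- values of `f` separate them by at least `L + 2`.
  rw [markLength] at ht ht'
  rcases lt_or_gt_of_ne hpp with hlt | hlt
  · have := Nat.mul_le_mul_left (L + 2) (show f (p.trunc L) + 1 + 1 ≤ f (p'.trunc L) + 1 by omega)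
    rw [mul_add (L + 2) (_ + 1) 1] at this
    omega
  · have := Nat.mul_le_mul_left (L + 2) (show f (p'.trunc L) + 1 + 1 ≤ f (p.trunc L) + 1 by omega)
    rw [mul_add (L + 2) (_ + 1) 1] at this
    omega

end Neretin

/-! ## The Chabauty topology -/

section Chabauty

variable {G : Type*} [Group G] [TopologicalSpace G]

/-- The trivial subgroup is in the Chabauty closure of a set of closed subgroups if
every compact set without the identity is missed by one of them. -/
theorem mem_closure_of_forall_isCompact {S : Set (ClosedSubgroup G)} {K₀ : ClosedSubgroup G}
    (hK₀ : K₀.toSubgroup = ⊥)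
    (h : ∀ C : Set G, IsCompact C → 1 ∉ C → ∃ K ∈ S, (K : Set G) ∩ C = ∅) : K₀ ∈ closure S := by
  have hmem : ∀ g, g ∈ K₀ ↔ g = 1 := fun g => by
    rw [← Subgroup.mem_bot, ← hK₀]; rfl
  rw [(TopologicalSpace.isTopologicalBasis_of_subbasis rfl).mem_closure_iff]
  rintro _ ⟨F, ⟨hFfin, hFS⟩, rfl⟩ hK
  -- Only the conditions of missing a compact set matter, and finitely many of these merge into one.
  -- An open set meeting the trivial subgroup contains 1 and hence meets every subgroup.
  have key : ∃ C : Set G, IsCompact C ∧ 1 ∉ C ∧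
      ∀ K : ClosedSubgroup G, (K : Set G) ∩ C = ∅ → K ∈ ⋂₀ F := by
    induction F, hFfin using Set.Finite.induction_on with
    | empty => exact ⟨∅, isCompact_empty, by simp, by simp⟩
    | @insert V F _ _ ih =>
      obtain ⟨C, hC, h1, hCF⟩ := ih ((Set.subset_insert _ _).trans hFS)
        (fun s hs => hK s (Set.mem_insert_of_mem _ hs))
      have hKV := hK V (Set.mem_insert _ _)
      rcases hFS (Set.mem_insert _ _) with ⟨C', hC', rfl⟩ | ⟨U, hU, rfl⟩
      · refine ⟨C ∪ C', hC.union hC', ?_, fun K hKC => ?_⟩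
        · rintro (h' | h')
          · exact h1 h'
          · exact Set.eq_empty_iff_forall_notMem.1 hKV 1 ⟨(hmem 1).2 rfl, h'⟩
        · rw [Set.inter_union_distrib_left, Set.union_empty_iff] at hKC
          rw [Set.sInter_insert]
          exact ⟨hKC.2, hCF K hKC.1⟩
      · refine ⟨C, hC, h1, fun K hKC => ?_⟩
        rw [Set.sInter_insert]
        obtain ⟨g, hg, hgU⟩ := hKV
        obtain rfl := (hmem g).1 hg
        exact ⟨⟨1, one_mem K, hgU⟩, hCF K hKC⟩
  obtain ⟨C, hC, h1, hCF⟩ := key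
  obtain ⟨K, hKS, hKC⟩ := h C hC h1
  exact ⟨K, hCF K hKC, hKS⟩

theorem exists_mem_conjugacyClass [IsTopologicalGroup G] (H : ClosedSubgroup G) (g : G) :
    ∃ K ∈ conjugacyClass H, ∀ x ∈ K, ∃ h ∈ H, x = g * h * g⁻¹ := by
  refine ⟨⟨H.toSubgroup.map (MulAut.conj g).toMonoidHom, ?_⟩, ⟨g, rfl⟩, ?_⟩
  · have := (((Homeomorph.mulLeft g).trans (Homeomorph.mulRight g⁻¹)).isClosedMap) _ H.isClosed'
    exact this
  · rintro _ ⟨h, hh, rfl⟩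
    exact ⟨h, hh, rfl⟩

end Chabauty

/-! ### Conclusion -/

theorem mainTheorem9 (d k : ℕ) (hd : 2 ≤ d) (hk : 2 ≤ k) :
    IsDiscrete (ThompsonF d k : Set (NeretinGroup d k)) ∧
    ∃ hF : IsClosed (ThompsonF d k : Set (NeretinGroup d k)),
      (⟨ThompsonF d k, hF⟩ : ClosedSubgroup (NeretinGroup d k)) ∈
        piecewiseFixingMeasure (NeretinGroup d k) (Neretin.Ends d k) ∧
      ¬ IsConfined (⟨ThompsonF d k, hF⟩ : ClosedSubgroup (NeretinGroup d k)) := by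
  have hdisc : DiscreteTopology (ThompsonF d k) := Neretin.discreteTopology_thompsonF hd
  have hF : IsClosed (ThompsonF d k : Set (NeretinGroup d k)) := Subgroup.isClosed_of_discrete
  refine ⟨⟨hdisc⟩, hF, Neretin.thompsonF_mem_piecewiseFixingMeasure hF, fun hconf => ?_⟩
  refine hconf ⟨⊥, isClosed_singleton⟩ (mem_closure_of_forall_isCompact rfl fun C hC h1 => ?_) rfl
  obtain ⟨L, hL⟩ := Neretin.exists_forall_movesSubtree hC h1
  obtain ⟨g, hg⟩ := Neretin.exists_conj_not_movesSubtree (k := k) hd L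
  obtain ⟨K, hK, hKg⟩ := exists_mem_conjugacyClass
    (⟨ThompsonF d k, hF⟩ : ClosedSubgroup (NeretinGroup d k)) g⁻¹
  refine ⟨K, hK, Set.eq_empty_iff_forall_notMem.2 ?_⟩
  rintro x ⟨hxK, hxC⟩
  obtain ⟨h, hh, rfl⟩ := hKg x hxK
  have := hL _ hxC
  rw [inv_inv] at this
  exact hg h hh this
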